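/- \textbf{Setting.} An operational probabilistic theory (OPT) consists of systems, with composition $\mathsf{AB}$ and a trivial system $\mathsf I$ (systems and events form a monoidal category), and of finite families of events, called tests, closed under sequential composition, parallel composition $\boxtimes$, relabelling of outcomes and coarse-graining. Every event belongs to a test. Every event of a test from $\mathsf I$ to $\mathsf I$ has a probability; these are nonnegative, sum to $1$ over the test, and multiply under composition. An event is deterministic if it forms a singleton test. States of $\mathsf A$ are preparation events $\mathsf I\to\mathsf A$, identified when all observation events $a:\mathsf A\to\mathsf I$ give them the same probabilities $(a|\rho)$; sums and differences of states are taken in the linear span $\mathsf{St}_{\mathbb R}(\mathsf A)$. $\mathsf{St}_1(\mathsf A)$ is the set of deterministic states. The theory is assumed strongly causal: for a test $\{\mathcal A_i\}_{i\in X}$ and tests $\{\mathcal B^{i}_j\}_{j\in Y}$ $(i\in X)$, the family $\{\mathcal B^{i}_j\mathcal A_i\}_{(i,j)}$ is a test. In particular the deterministic effect $e$ of a system is unique. Let $\|\delta\|_{op}=\sup_{a}(2a-e|\delta)$, the supremum being over all effects $a$. Fix an obit $\mathsf B$, i.e. a system such that for every system $\mathsf S$ there are $k<\infty$ and deterministic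 $\mathcal C:\mathsf S\to\mathsf B^{\boxtimes k}$, $\mathcal F:\mathsf B^{\boxtimes k}\to\mathsf S$ with $\mathcal F\mathcal C=\mathcal I_{\mathsf S}$ as transformations. A state $\Omega$ of $\mathsf{AC}$ is a dilation of a state $\rho$ of $\mathsf A$ if $(\mathcal I_{\mathsf A}\boxtimes e)\Omega=\rho$ for a deterministic effect $e$ of $\mathsf C$; $D_\rho$ is the set of all dilations of $\rho$. A refinement of $\Omega$ is a subfamily $\{\Psi_i\}$ of a preparation test with $\sum_i\Psi_i=\Omega$. \textbf{Definitions.} Let $\rho\in\mathsf{St}_1(\mathsf A)$. A compression scheme for $N$ copies into $M\ge 0$ obits is a pair of deterministic events $\mathcal E:\mathsf A^{\boxtimes N}\to\mathsf B^{\boxtimes M}$, $\mathcal D:\mathsf B^{\boxtimes M}\to\mathsf A^{\boxtimes N}$. (1) $E_{N,M,\varepsilon}(\rho)$ is the set of compression schemes with $$\sup_{\mathsf C,\{\Psi_i\}}\ \sum_i\big\|[(\mathcal D\mathcal E)\boxtimes\mathcal I_{\mathsf C}]\Psi_i-\Psi_i\big\|_{op}<\varepsilon ,$$ where $\mathsf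 C$ ranges over all systems and $\{\Psi_i\}$ over all refinements of all dilations of $\rho^{\boxtimes N}$ in $\mathsf A^{\boxtimes N}\mathsf C$. (2) $E^C_{N,M,\delta}(\rho)$ is the set of compression schemes with $$\sup_{\mathsf C,\{\Psi_i\},\{a_j\}}\ L^{-1}\,\big|I(X:Y)-I(X:\tilde Y)\big|<\delta ,\qquad L=\log_2(mn-1),$$ where $\{\Psi_i\}$ ranges over all preparation tests of $\mathsf A^{\boxtimes N}\mathsf C$ with $\sum_i\Psi_i\in D_{\rho^{\boxtimes N}}$, $\{a_j\}$ over all observation tests of $\mathsf A^{\boxtimes N}\mathsf C$, and $n$, $m$ are their numbers of outcomes. Here $(X,Y)$ has joint distribution $p_{ij}=(a_j|\Psi_i)$, $(X,\tilde Y)$ has joint distribution $q_{ij}=(a_j|(\mathcal D\mathcal E\boxtimes\mathcal I_{\mathsf C})\Psi_i)$, and $I(\cdot:\cdot)$ is the Shannon mutual information in bits. If $m=1$ or $n=1$, both mutual informations vanish and the normalized difference is taken to be $0$. Define, with values in $[0,\infty]$, $$I(\rho)=\lim_{\varepsilon\to0^+}\limsup_{N\to\infty}\frac{\min\{M:E_{N,M,\varepsilon}(\rho)\ne\emptyset\}}{N},\qquad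 I^C(\rho)=\lim_{\delta\to0^+}\limsup_{N\to\infty}\frac{\min\{M:E^C_{N,M,\delta}(\rho)\ne\emptyset\}}{N}.$$ \textbf{Lemma.} For every system $\mathsf A$ and every $\rho\in\mathsf{St}_1(\mathsf A)$ both limits exist, and $$I(\rho)\ \ge\ I^C(\rho).$$ -/

import Mathlib

open CategoryTheory MonoidalCategory Filter Topology
open scoped ENNReal

universe u v

/-- An operational probabilistic theory. The systems are the objects of a monoidal category
(`A ⊗ B` is the composite system, `𝟙_ C` the trivial system), the events are its morphisms, with
`≫` the sequential and `⊗ₘ` the parallel composition. Preparation events of `A` are the morphisms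
`𝟙_ C ⟶ A`, observation events of `A` are the morphisms `A ⟶ 𝟙_ C`, and `prob` gives the
probability of a closed circuit. -/
structure OPT (C : Type u) [Category.{v} C] [MonoidalCategory C] where
  /-- The finite collections of events that form a test; the index type is the outcome space. -/
  IsTest : ∀ {A B : C} {X : Type}, (X → (A ⟶ B)) → Prop
  /-- The probability of an event of the trivial system. -/
  prob : (𝟙_ C ⟶ 𝟙_ C) → ℝ
  finite_outcomes : ∀ {A B : C} {X : Type} {f : X → (A ⟶ B)}, IsTest f → Finite X
  /-- Every event belongs to a test. -/
  exists_test : ∀ {A B : C} (f : A ⟶ B), ∃ (X : Type) (t : X → (A ⟶ B)) (x : X),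
    IsTest t ∧ t x = f
  /-- The names of the outcomes are irrelevant. -/
  relabel : ∀ {A B : C} {X Y : Type} {f : X → (A ⟶ B)} (σ : Y ≃ X), IsTest f → IsTest (f ∘ σ)
  test_id : ∀ A : C, IsTest (fun _ : Unit => 𝟙 A)
  test_comp : ∀ {A B D : C} {X Y : Type} {f : X → (A ⟶ B)} {g : Y → (B ⟶ D)},
    IsTest f → IsTest g → IsTest (fun p : X × Y => f p.1 ≫ g p.2)
  test_tensor : ∀ {A B A' B' : C} {X Y : Type} {f : X → (A ⟶ B)} {g : Y → (A' ⟶ B')},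
    IsTest f → IsTest g → IsTest (fun p : X × Y => f p.1 ⊗ₘ g p.2)
  /-- The canonical identifications of systems are deterministic. -/
  test_associator_hom : ∀ A B D : C, IsTest (fun _ : Unit => (α_ A B D).hom)
  test_associator_inv : ∀ A B D : C, IsTest (fun _ : Unit => (α_ A B D).inv)
  test_leftUnitor_hom : ∀ A : C, IsTest (fun _ : Unit => (λ_ A).hom)
  test_leftUnitor_inv : ∀ A : C, IsTest (fun _ : Unit => (λ_ A).inv)
  test_rightUnitor_hom : ∀ A : C, IsTest (fun _ : Unit => (ρ_ A).hom)
  test_rightUnitor_inv : ∀ A : C, IsTest (fun _ : Unit => (ρ_ A).inv)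
  prob_nonneg : ∀ s : 𝟙_ C ⟶ 𝟙_ C, 0 ≤ prob s
  prob_sum : ∀ {X : Type} [Fintype X] {t : X → (𝟙_ C ⟶ 𝟙_ C)}, IsTest t → ∑ x, prob (t x) = 1
  /-- Tests of the trivial system are independent. -/
  prob_comp : ∀ s t : 𝟙_ C ⟶ 𝟙_ C, prob (s ≫ t) = prob s * prob t
  /-- Tests can be coarse-grained: events with the same image under `φ` are merged into one event,
  which is their sum in every circuit. -/
  coarse_graining : ∀ {A B : C} {X Y : Type} [Fintype X] [DecidableEq Y] {f : X → (A ⟶ B)}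
    (φ : X → Y), Function.Surjective φ → IsTest f →
      ∃ g : Y → (A ⟶ B), IsTest g ∧ ∀ (y : Y) (R : C) (Ψ : 𝟙_ C ⟶ A ⊗ R) (a : B ⊗ R ⟶ 𝟙_ C),
        prob (Ψ ≫ (g y ▷ R) ≫ a) = ∑ x with φ x = y, prob (Ψ ≫ (f x ▷ R) ≫ a)

/-- Shannon mutual information (in bits) of a joint distribution `p` on `X × Y`. -/
noncomputable def mutualInfo {X Y : Type} [Fintype X] [Fintype Y] (p : X → Y → ℝ) : ℝ :=
  ∑ i, ∑ j, p i j * Real.logb 2 (p i j / ((∑ j', p i j') * (∑ i', p i' j)))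

/-- The composite of `n` copies of `A`. -/
def sysPow {C : Type u} [Category.{v} C] [MonoidalCategory C] (A : C) : ℕ → C
  | 0 => 𝟙_ C
  | n + 1 => sysPow A n ⊗ A

/-- The parallel composition of `n` copies of a preparation event. -/
def prepPow {C : Type u} [Category.{v} C] [MonoidalCategory C] {A : C} (r : 𝟙_ C ⟶ A) :
    (n : ℕ) → (𝟙_ C ⟶ sysPow A n)
  | 0 => 𝟙 (𝟙_ C)
  | n + 1 => (λ_ (𝟙_ C)).inv ≫ (prepPow r n ⊗ₘ r)

namespace OPT

variable {C : Type u} [Category.{v} C] [MonoidalCategory C] (O : OPT C)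

/-- Deterministic events: those that form a singleton test. -/
def IsDet {A B : C} (f : A ⟶ B) : Prop := O.IsTest (fun _ : Unit => f)

/-- Strong causality: the test performed at the second step may depend on the outcome of the first
one. -/
def StronglyCausal : Prop :=
  ∀ {A B D : C} {X Y : Type} (f : X → (A ⟶ B)) (g : X → Y → (B ⟶ D)),
    O.IsTest f → (∀ i, O.IsTest (g i)) → O.IsTest (fun p : X × Y => f p.1 ≫ g p.1 p.2)

/-- The state of a preparation event `r`, as a functional on observation events. Two preparation
events are the same state iff these functionals agree; the real span of the functionals is the
vector space of states, in which sums and differences of states are taken. -/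
def state {A : C} (r : 𝟙_ C ⟶ A) : (A ⟶ 𝟙_ C) → ℝ := fun a => O.prob (r ≫ a)

/-- Two events are the same transformation: they agree in all circuits with an ancilla. -/
def SameTransformation {A B : C} (f g : A ⟶ B) : Prop :=
  ∀ (R : C) (Ψ : 𝟙_ C ⟶ A ⊗ R) (a : B ⊗ R ⟶ 𝟙_ C),
    O.prob (Ψ ≫ (f ▷ R) ≫ a) = O.prob (Ψ ≫ (g ▷ R) ≫ a)

/-- `B` is an obit: every system can be encoded without error into finitely many copies of `B`. -/
def IsObit (B : C) : Prop :=
  ∀ S : C, ∃ (k : ℕ) (E : S ⟶ sysPow B k) (D : sysPow B k ⟶ S),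
    O.IsDet E ∧ O.IsDet D ∧ O.SameTransformation (E ≫ D) (𝟙 S)

/-- The operational norm `sup_a (2a - e | δ)` of an element `δ` of the span of the states of `A`,
where `a` runs over the effects and `e` is the deterministic effect (in a causal theory, all
deterministic observation events are the same effect). -/
noncomputable def opNorm {A : C} (δ : (A ⟶ 𝟙_ C) → ℝ) : ℝ :=
  sSup {x : ℝ | ∃ a e : A ⟶ 𝟙_ C, O.IsDet e ∧ x = 2 * δ a - δ e}

/-- `Ω` is a dilation of `r`, with dilating system `R`. -/
def IsDilation {A R : C} (Ω : 𝟙_ C ⟶ A ⊗ R) (r : 𝟙_ C ⟶ A) : Prop :=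
  ∃ e : R ⟶ 𝟙_ C, O.IsDet e ∧ O.state (Ω ≫ (A ◁ e) ≫ (ρ_ A).hom) = O.state r

/-- `Ψ` is a refinement of `Ω`: a subcollection of a test, with sum `Ω`. -/
def IsRefinement {A : C} {Y : Type} [Fintype Y] (Ψ : Y → (𝟙_ C ⟶ A)) (Ω : 𝟙_ C ⟶ A) : Prop :=
  (∃ (X : Type) (t : X → (𝟙_ C ⟶ A)) (ι : Y ↪ X), O.IsTest t ∧ ∀ y, t (ι y) = Ψ y) ∧
    O.state Ω = ∑ y, O.state (Ψ y)

/-- The worst-case disturbance `sup ∑ i, ‖(T ⊠ I_R) Ψ i - Ψ i‖` caused by `T`, over all ancillas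
`R` and all refinements `Ψ` of dilations of `r`. -/
noncomputable def disturbance {A : C} (r : 𝟙_ C ⟶ A) (T : A ⟶ A) : EReal :=
  sSup {x : EReal | ∃ (R : C) (Ω : 𝟙_ C ⟶ A ⊗ R) (Y : Type) (_ : Fintype Y)
    (Ψ : Y → (𝟙_ C ⟶ A ⊗ R)), O.IsDilation Ω r ∧ O.IsRefinement Ψ Ω ∧
      x = ((∑ i, O.opNorm (O.state (Ψ i ≫ (T ▷ R)) - O.state (Ψ i)) : ℝ) : EReal)}

/-- The worst-case normalized change of the mutual information between preparation and observation
outcomes caused by `T`, over all ancillas `R`, all preparation tests `Ψ` with sum a dilation of `r`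
and all observation tests `a`. If one of the tests has a single outcome, then both mutual
informations vanish and the normalized change is `0`; this is what the convention `0⁻¹ = 0` gives
when the normalization is degenerate. -/
noncomputable def infoDisturbance {A : C} (r : 𝟙_ C ⟶ A) (T : A ⟶ A) : EReal :=
  sSup {x : EReal | ∃ (R : C) (Ω : 𝟙_ C ⟶ A ⊗ R) (X Y : Type) (_ : Fintype X) (_ : Fintype Y)
    (Ψ : X → (𝟙_ C ⟶ A ⊗ R)) (a : Y → (A ⊗ R ⟶ 𝟙_ C)),
      O.IsDilation Ω r ∧ O.IsTest Ψ ∧ O.state Ω = ∑ i, O.state (Ψ i) ∧ O.IsTest a ∧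
      x = (((Real.logb 2 ((Fintype.card X : ℝ) * (Fintype.card Y : ℝ) - 1))⁻¹ *
        |mutualInfo (fun i j => O.prob (Ψ i ≫ a j)) -
          mutualInfo (fun i j => O.prob (Ψ i ≫ (T ▷ R) ≫ a j))| : ℝ) : EReal)}

/-- `(E, D)` is an `(ε, N)`-reliable compression scheme for `r` into `M` copies of `B`. -/
def IsReliable {A B : C} (r : 𝟙_ C ⟶ A) (N M : ℕ) (ε : ℝ) (E : sysPow A N ⟶ sysPow B M)
    (D : sysPow B M ⟶ sysPow A N) : Prop :=
  O.IsDet E ∧ O.IsDet D ∧ O.disturbance (prepPow r N) (E ≫ D) < (ε : EReal)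

/-- `(E, D)` is a compression scheme for `r` into `M` copies of `B` that preserves the normalized
mutual information up to `δ`. -/
def IsInfoReliable {A B : C} (r : 𝟙_ C ⟶ A) (N M : ℕ) (δ : ℝ) (E : sysPow A N ⟶ sysPow B M)
    (D : sysPow B M ⟶ sysPow A N) : Prop :=
  O.IsDet E ∧ O.IsDet D ∧ O.infoDisturbance (prepPow r N) (E ≫ D) < (δ : EReal)

/-- Smallest achievable compression ratio for length `N` to tolerance `ε` (`⊤` if no `M` works). -/
noncomputable def ratio {A : C} (B : C) (r : 𝟙_ C ⟶ A) (ε : ℝ) (N : ℕ) : ℝ≥0∞ :=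
  sInf {x : ℝ≥0∞ | ∃ (M : ℕ) (E : sysPow A N ⟶ sysPow B M) (D : sysPow B M ⟶ sysPow A N),
    O.IsReliable r N M ε E D ∧ x = (M : ℝ≥0∞)} / (N : ℝ≥0∞)

/-- The analogue of `ratio` for the preservation of mutual information. -/
noncomputable def infoRatio {A : C} (B : C) (r : 𝟙_ C ⟶ A) (δ : ℝ) (N : ℕ) : ℝ≥0∞ :=
  sInf {x : ℝ≥0∞ | ∃ (M : ℕ) (E : sysPow A N ⟶ sysPow B M) (D : sysPow B M ⟶ sysPow A N),
    O.IsInfoReliable r N M δ E D ∧ x = (M : ℝ≥0∞)} / (N : ℝ≥0∞)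

/-- The rate `R_ε`: the limit superior of the ratios as the length tends to infinity. -/
noncomputable def rate {A : C} (B : C) (r : 𝟙_ C ⟶ A) (ε : ℝ) : ℝ≥0∞ :=
  limsup (fun N : ℕ => O.ratio B r ε N) atTop

/-- The rate `R^C_δ`. -/
noncomputable def infoRate {A : C} (B : C) (r : 𝟙_ C ⟶ A) (δ : ℝ) : ℝ≥0∞ :=
  limsup (fun N : ℕ => O.infoRatio B r δ N) atTop

/-- The information content `I` of the state of `r`, in units of the obit `B`. -/
noncomputable def infoContent {A : C} (B : C) (r : 𝟙_ C ⟶ A) : ℝ≥0∞ :=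
  limUnder (𝓝[>] (0 : ℝ)) (fun ε => O.rate B r ε)

/-- The mutual-information-based quantity `I^C` of the state of `r`, in units of the obit `B`. -/
noncomputable def infoContentC {A : C} (B : C) (r : 𝟙_ C ⟶ A) : ℝ≥0∞ :=
  limUnder (𝓝[>] (0 : ℝ)) (fun δ => O.infoRate B r δ)

end OPT

-- Operational closeness forces the statistics of every observation test to be close, and mutual
-- information is continuous in those statistics. By causality the differences of outcome
-- probabilities before and after a deterministic map sum to zero, so their `ℓ¹` norm is twice their
-- positive part, which one coarse-grained effect attains; hence the operational norm bounds it
-- (`sum_abs_prob_sub_le_opNorm`). Continuity of entropy gives an error of order `ε log (mn)` plus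
-- terms vanishing with `ε`. Division by `log (mn - 1)` leaves `6 (2ε - ε log ε)`, independent of
-- the tests and of `N` (`normalized_abs_mutualInfo_sub_le`). An `ε`-reliable scheme therefore
-- preserves information up to any larger `δ`. Both rates are antitone in the tolerance, so the
-- limits exist and inherit the inequality.

-- Continuity of entropy

open Real in
/-- Modulus of continuity of `x ↦ -x log x` on the unit interval. -/
theorem abs_negMulLog_sub_le {x y : ℝ} (hx : 0 ≤ x) (hy : 0 ≤ y) (hx1 : x ≤ 1) (hy1 : y ≤ 1) :
    |negMulLog x - negMulLog y| ≤ negMulLog |x - y| + |x - y| := by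
  wlog hxy : y ≤ x generalizing x y
  · rw [abs_sub_comm, abs_sub_comm x y]
    exact this hy hx hy1 hx1 (le_of_not_ge hxy)
  obtain ⟨h, rfl⟩ : ∃ h, x = y + h := ⟨x - y, by ring⟩
  have h0 : 0 ≤ h := by linarith
  have h1 : h ≤ 1 := by linarith
  rw [add_sub_cancel_left, abs_of_nonneg h0]
  have hη : 0 ≤ negMulLog h := negMulLog_nonneg h0 h1
  rcases h0.eq_or_lt with rfl | hpos
  · simp
  rcases hy.eq_or_lt with rfl | ypos
  · simp only [zero_add, negMulLog_zero, sub_zero, abs_of_nonneg hη]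
    linarith
  have l1 : log y ≤ log (y + h) := log_le_log ypos (by linarith)
  have l2 : log h ≤ log (y + h) := log_le_log hpos (by linarith)
  have l3 : log (y + h) ≤ 0 := log_nonpos (by linarith) hx1
  have l4 : y * (log (y + h) - log y) ≤ h := by
    rw [← log_div (by linarith) ypos.ne']
    calc y * log ((y + h) / y) ≤ y * ((y + h) / y - 1) :=
          mul_le_mul_of_nonneg_left (log_le_sub_one_of_pos (by positivity)) hy
      _ = h := by field_simp; ring
  -- `m1` and `m2` bound the increase of `negMulLog` from `y` to `y + h` by `negMulLog h`; `l4` and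
  -- `m3` bound the decrease by `h`.
  have m1 := mul_le_mul_of_nonneg_left l1 hy
  have m2 := mul_le_mul_of_nonneg_left l2 h0
  have m3 := mul_nonpos_of_nonneg_of_nonpos h0 l3
  simp only [negMulLog] at *
  rw [abs_le]
  constructor <;> nlinarith

-- Tangent line at `c` of the concave function `h ↦ -h log h + h`. Being affine in `h`, it can be
-- summed over outcomes, which replaces Jensen's inequality.
open Real in
theorem negMulLog_add_self_le {h c : ℝ} (hh : 0 ≤ h) (hc : 0 < c) :
    negMulLog h + h ≤ h * (-log c) + c := by
  rcases hh.eq_or_lt with rfl | hpos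
  · simpa using hc.le
  have := log_le_sub_one_of_pos (div_pos hc hpos)
  rw [log_div hc.ne' hpos.ne'] at this
  have m := mul_le_mul_of_nonneg_left this hh
  have e : h * (c / h - 1) = c - h := by field_simp
  rw [e] at m
  simp only [negMulLog]
  linarith

open Real in
/-- Continuity of the Shannon entropy (in nats) with respect to the `ℓ¹` distance. -/
theorem abs_sum_negMulLog_sub_le {ι : Type*} [Fintype ι] {p q : ι → ℝ} {ε d : ℝ}
    (hp : ∀ i, 0 ≤ p i) (hq : ∀ i, 0 ≤ q i) (hp1 : ∀ i, p i ≤ 1) (hq1 : ∀ i, q i ≤ 1)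
    (hε : 0 < ε) (hε1 : ε ≤ 1) (hd : 1 ≤ d) (hι : (Fintype.card ι : ℝ) ≤ d)
    (hpq : ∑ i, |p i - q i| ≤ ε) :
    |∑ i, negMulLog (p i) - ∑ i, negMulLog (q i)| ≤ ε * log d + negMulLog ε + ε := by
  -- The tangent point is the deviation `ε` spread evenly over `d` outcomes.
  have hc : 0 < ε / d := by positivity
  have hlog : log (ε / d) = log ε - log d := log_div hε.ne' (by linarith)
  have hneg : 0 ≤ -log (ε / d) := by
    rw [hlog]
    linarith [log_nonpos hε.le hε1, log_nonneg hd]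
  calc |∑ i, negMulLog (p i) - ∑ i, negMulLog (q i)|
      ≤ ∑ i, |negMulLog (p i) - negMulLog (q i)| := by
        rw [← Finset.sum_sub_distrib]
        exact Finset.abs_sum_le_sum_abs _ _
    _ ≤ ∑ i, (|p i - q i| * (-log (ε / d)) + ε / d) :=
        Finset.sum_le_sum fun i _ =>
          (abs_negMulLog_sub_le (hp i) (hq i) (hp1 i) (hq1 i)).trans
            (negMulLog_add_self_le (abs_nonneg _) hc)
    _ = (∑ i, |p i - q i|) * (-log (ε / d)) + Fintype.card ι * (ε / d) := by
        rw [Finset.sum_add_distrib, ← Finset.sum_mul]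
        simp
    _ ≤ ε * (-log (ε / d)) + d * (ε / d) := by gcongr
    _ = ε * log d + negMulLog ε + ε := by
        rw [hlog, negMulLog, mul_div_cancel₀ _ (by linarith)]
        ring

-- Continuity of mutual information

open Real in
/-- `I(X : Y) = H(X) + H(Y) - H(X, Y)`. -/
theorem mutualInfo_mul_log_two {X Y : Type} [Fintype X] [Fintype Y] {p : X → Y → ℝ}
    (hp : ∀ i j, 0 ≤ p i j) :
    mutualInfo p * log 2 = ∑ i, negMulLog (∑ j, p i j) + ∑ j, negMulLog (∑ i, p i j) -
      ∑ x : X × Y, negMulLog (p x.1 x.2) := by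
  have key : ∀ i j, p i j * logb 2 (p i j / ((∑ j', p i j') * (∑ i', p i' j))) * log 2 =
      p i j * log (p i j) - p i j * log (∑ j', p i j') - p i j * log (∑ i', p i' j) := by
    intro i j
    rcases (hp i j).eq_or_lt with h | h
    · simp [← h]
    have hi : 0 < ∑ j', p i j' :=
      Finset.sum_pos' (fun j _ => hp i j) ⟨j, Finset.mem_univ _, h⟩
    have hj : 0 < ∑ i', p i' j :=
      Finset.sum_pos' (fun i _ => hp i j) ⟨i, Finset.mem_univ _, h⟩
    rw [mul_assoc, logb, div_mul_cancel₀ _ (log_pos one_lt_two).ne',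
      log_div h.ne' (by positivity), log_mul hi.ne' hj.ne']
    ring
  have expand : mutualInfo p * log 2 = ∑ i, ∑ j, (p i j * log (p i j) -
      p i j * log (∑ j', p i j') - p i j * log (∑ i', p i' j)) := by
    rw [mutualInfo, Finset.sum_mul]
    refine Finset.sum_congr rfl fun i _ => ?_
    rw [Finset.sum_mul]
    exact Finset.sum_congr rfl fun j _ => key i j
  rw [expand]
  simp_rw [Finset.sum_sub_distrib, Fintype.sum_prod_type, negMulLog, neg_mul,
    Finset.sum_neg_distrib]
  rw [Finset.sum_comm (f := fun i j => p i j * log (∑ i', p i' j))]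
  simp_rw [← Finset.sum_mul]
  ring

open Real in
/-- Continuity of the mutual information with respect to the `ℓ¹` distance. -/
theorem abs_mutualInfo_sub_le {X Y : Type} [Fintype X] [Fintype Y] [Nonempty X] [Nonempty Y]
    {p q : X → Y → ℝ} {ε : ℝ} (hp : ∀ i j, 0 ≤ p i j) (hq : ∀ i j, 0 ≤ q i j)
    (hp1 : ∑ i, ∑ j, p i j = 1) (hq1 : ∑ i, ∑ j, q i j = 1) (hε : 0 < ε) (hε1 : ε ≤ 1)
    (hpq : ∑ i, ∑ j, |p i j - q i j| ≤ ε) :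
    |mutualInfo p - mutualInfo q| * log 2 ≤
      3 * (ε * log (Fintype.card X * Fintype.card Y) + negMulLog ε + ε) := by
  have cX : (1 : ℝ) ≤ Fintype.card X := by exact_mod_cast Fintype.card_pos
  have cY : (1 : ℝ) ≤ Fintype.card Y := by exact_mod_cast Fintype.card_pos
  have cXY : (1 : ℝ) ≤ Fintype.card X * Fintype.card Y := one_le_mul_of_one_le_of_one_le cX cY
  have rowLe : ∀ {p : X → Y → ℝ}, (∀ i j, 0 ≤ p i j) → ∑ i, ∑ j, p i j = 1 →
      ∀ i, ∑ j, p i j ≤ 1 := fun {p} h h1 i => h1 ▸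
    Finset.single_le_sum (f := fun i => ∑ j, p i j)
      (fun i _ => Finset.sum_nonneg fun j _ => h i j) (Finset.mem_univ i)
  have colLe : ∀ {p : X → Y → ℝ}, (∀ i j, 0 ≤ p i j) → ∑ i, ∑ j, p i j = 1 →
      ∀ j, ∑ i, p i j ≤ 1 := fun {p} h h1 j => by
    rw [Finset.sum_comm] at h1
    exact h1 ▸ Finset.single_le_sum (f := fun j => ∑ i, p i j)
      (fun j _ => Finset.sum_nonneg fun i _ => h i j) (Finset.mem_univ j)
  have entryLe : ∀ {p : X → Y → ℝ}, (∀ i j, 0 ≤ p i j) → ∑ i, ∑ j, p i j = 1 →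
      ∀ i j, p i j ≤ 1 := fun {p} h h1 i j =>
    (Finset.single_le_sum (f := fun j => p i j) (fun j _ => h i j) (Finset.mem_univ j)).trans
      (rowLe h h1 i)
  -- Marginals are no farther apart in `ℓ¹` than the joint distributions, and `d = mn` serves for
  -- all three entropies.
  have b1 := abs_sum_negMulLog_sub_le (p := fun i => ∑ j, p i j) (q := fun i => ∑ j, q i j)
    (fun i => Finset.sum_nonneg fun j _ => hp i j) (fun i => Finset.sum_nonneg fun j _ => hq i j)
    (rowLe hp hp1) (rowLe hq hq1) hε hε1 cXY (le_mul_of_one_le_right (by linarith) cY)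
    ((Finset.sum_le_sum (g := fun i => ∑ j, |p i j - q i j|) fun i _ => by
      rw [← Finset.sum_sub_distrib]
      exact Finset.abs_sum_le_sum_abs _ _).trans hpq)
  have b2 := abs_sum_negMulLog_sub_le (p := fun j => ∑ i, p i j) (q := fun j => ∑ i, q i j)
    (fun j => Finset.sum_nonneg fun i _ => hp i j) (fun j => Finset.sum_nonneg fun i _ => hq i j)
    (colLe hp hp1) (colLe hq hq1) hε hε1 cXY (le_mul_of_one_le_left (by linarith) cX)
    ((Finset.sum_le_sum (g := fun j => ∑ i, |p i j - q i j|) fun j _ => by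
      rw [← Finset.sum_sub_distrib]
      exact Finset.abs_sum_le_sum_abs _ _).trans (by rwa [Finset.sum_comm]))
  have b3 := abs_sum_negMulLog_sub_le (p := fun x : X × Y => p x.1 x.2)
    (q := fun x : X × Y => q x.1 x.2) (fun _ => hp _ _) (fun _ => hq _ _)
    (fun _ => entryLe hp hp1 _ _) (fun _ => entryLe hq hq1 _ _) hε hε1 cXY (by simp)
    (by rwa [Fintype.sum_prod_type])
  rw [← abs_of_pos (log_pos one_lt_two), ← abs_mul, sub_mul, mutualInfo_mul_log_two hp,
    mutualInfo_mul_log_two hq]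
  rw [abs_le] at b1 b2 b3 ⊢
  constructor <;> linarith

/-- Each entry is its own column marginal and the row marginal is `1`, so every logarithm of
positive weight is `log 1`. -/
theorem mutualInfo_eq_zero_of_unique_left {X Y : Type} [Fintype X] [Fintype Y] [Unique X]
    {p : X → Y → ℝ} (h : ∑ i, ∑ j, p i j = 1) : mutualInfo p = 0 := by
  simp only [mutualInfo, Fintype.sum_unique] at h ⊢
  refine Finset.sum_eq_zero fun j _ => ?_
  rcases eq_or_ne (p default j) 0 with h0 | h0 <;> simp [h0, h]

theorem mutualInfo_eq_zero_of_unique_right {X Y : Type} [Fintype X] [Fintype Y] [Unique Y]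
    {p : X → Y → ℝ} (h : ∑ i, ∑ j, p i j = 1) : mutualInfo p = 0 := by
  simp only [mutualInfo, Fintype.sum_unique] at h ⊢
  refine Finset.sum_eq_zero fun i _ => ?_
  rcases eq_or_ne (p i default) 0 with h0 | h0 <;> simp [h0, h]

open Real in
/-- The mutual information, normalized by `log (m n - 1)`, is continuous in the `ℓ¹` distance,
uniformly in the numbers `m`, `n` of outcomes. -/
theorem normalized_abs_mutualInfo_sub_le {X Y : Type} [Fintype X] [Fintype Y]
    {p q : X → Y → ℝ} {ε : ℝ} (hp : ∀ i j, 0 ≤ p i j) (hq : ∀ i j, 0 ≤ q i j)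
    (hp1 : ∑ i, ∑ j, p i j = 1) (hq1 : ∑ i, ∑ j, q i j = 1) (hε : 0 < ε) (hε1 : ε ≤ 1)
    (hpq : ∑ i, ∑ j, |p i j - q i j| ≤ ε) :
    (logb 2 ((Fintype.card X : ℝ) * (Fintype.card Y : ℝ) - 1))⁻¹ *
      |mutualInfo p - mutualInfo q| ≤ 6 * (2 * ε + negMulLog ε) := by
  have hη : 0 ≤ negMulLog ε := negMulLog_nonneg hε.le hε1
  have hX : Nonempty X := by
    by_contra h
    rw [not_nonempty_iff] at h
    simp at hp1
  have hY : Nonempty Y := by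
    by_contra h
    rw [not_nonempty_iff] at h
    simp at hp1
  rcases (Nat.one_le_iff_ne_zero.2 (Fintype.card_ne_zero (α := X))).eq_or_lt with cX | cX
  · obtain ⟨hu⟩ := Fintype.card_eq_one_iff_nonempty_unique.1 cX.symm
    rw [mutualInfo_eq_zero_of_unique_left hp1, mutualInfo_eq_zero_of_unique_left hq1]
    simp only [sub_self, abs_zero, mul_zero]
    positivity
  rcases (Nat.one_le_iff_ne_zero.2 (Fintype.card_ne_zero (α := Y))).eq_or_lt with cY | cY
  · obtain ⟨hu⟩ := Fintype.card_eq_one_iff_nonempty_unique.1 cY.symm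
    rw [mutualInfo_eq_zero_of_unique_right hp1, mutualInfo_eq_zero_of_unique_right hq1]
    simp only [sub_self, abs_zero, mul_zero]
    positivity
  have main := abs_mutualInfo_sub_le hp hq hp1 hq1 hε hε1 hpq
  have hd : (4 : ℝ) ≤ (Fintype.card X : ℝ) * (Fintype.card Y : ℝ) := by
    have : 2 * 2 ≤ Fintype.card X * Fintype.card Y := Nat.mul_le_mul cX cY
    exact_mod_cast this
  set d : ℝ := (Fintype.card X : ℝ) * (Fintype.card Y : ℝ)
  -- `d ≥ 4 > e` lets `log d` absorb the terms without a logarithm; `d ≤ (d - 1)²` then costs a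
  -- factor `2`, turning `3` into `6`.
  have hl : 1 ≤ log d := by
    rw [le_log_iff_exp_le (by linarith)]
    linarith [exp_one_lt_d9]
  have hl2 : log d ≤ 2 * log (d - 1) := by
    rw [← Nat.cast_ofNat, ← log_pow]
    exact log_le_log (by linarith) (by nlinarith)
  have h2 : 0 < log 2 := log_pos one_lt_two
  have hL : 0 < log (d - 1) := by linarith
  rw [logb, inv_div, div_mul_eq_mul_div, div_le_iff₀ hL, mul_comm (log 2)]
  nlinarith

-- From the operational norm to outcome statistics

namespace OPT

variable {C : Type u} [Category.{v} C] [MonoidalCategory C] {O : OPT C}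

theorem IsDet.comp {A B D : C} {f : A ⟶ B} {g : B ⟶ D} (hf : O.IsDet f) (hg : O.IsDet g) :
    O.IsDet (f ≫ g) :=
  O.relabel (Equiv.punitProd Unit).symm (O.test_comp hf hg)

theorem IsDet.whiskerRight {A B : C} {f : A ⟶ B} (hf : O.IsDet f) (R : C) :
    O.IsDet (f ▷ R) := by
  have h := O.relabel (Equiv.punitProd Unit).symm (O.test_tensor hf (O.test_id R))
  simpa only [IsDet, Function.comp_def, tensorHom_id] using h

theorem IsTest.comp_isDet {A B D : C} {X : Type} {f : X → (A ⟶ B)} {g : B ⟶ D}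
    (hf : O.IsTest f) (hg : O.IsDet g) : O.IsTest (fun x => f x ≫ g) :=
  O.relabel (Equiv.prodPUnit X).symm (O.test_comp hf hg)

theorem prob_le_one (s : 𝟙_ C ⟶ 𝟙_ C) : O.prob s ≤ 1 := by
  obtain ⟨X, t, x, ht, rfl⟩ := O.exists_test s
  have := O.finite_outcomes ht
  have := Fintype.ofFinite X
  rw [← O.prob_sum ht]
  exact Finset.single_le_sum (f := fun x => O.prob (t x)) (fun x _ => O.prob_nonneg _)
    (Finset.mem_univ x)

theorem sum_prob_comp {A : C} {X Y : Type} [Fintype X] [Fintype Y] {Ψ : X → (𝟙_ C ⟶ A)}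
    {a : Y → (A ⟶ 𝟙_ C)} (hΨ : O.IsTest Ψ) (ha : O.IsTest a) :
    ∑ i, ∑ j, O.prob (Ψ i ≫ a j) = 1 := by
  rw [← Fintype.sum_prod_type']
  exact O.prob_sum (O.test_comp hΨ ha)

/-- Causality: all deterministic effects give the same probabilities. -/
theorem StronglyCausal.prob_comp_eq (hO : O.StronglyCausal) {A : C} {e e' : A ⟶ 𝟙_ C}
    (he : O.IsDet e) (he' : O.IsDet e') (ψ : 𝟙_ C ⟶ A) : O.prob (ψ ≫ e) = O.prob (ψ ≫ e') := by
  classical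
  obtain ⟨X, t, x, ht, rfl⟩ := O.exists_test ψ
  have := O.finite_outcomes ht
  have := Fintype.ofFinite X
  have h1 := O.prob_sum (hO t (fun _ (_ : Unit) => e) ht fun _ => he)
  -- Switching to `e'` only after outcome `x` keeps the total at `1`; all other terms cancel.
  have h2 := O.prob_sum (hO t (fun i (_ : Unit) => if i = x then e' else e) ht fun i => by
    by_cases h : i = x
    · simp only [if_pos h]
      exact he'
    · simp only [if_neg h]
      exact he)
  simp only [Fintype.sum_prod_type, Finset.univ_unique, Finset.sum_singleton] at h1 h2
  rw [← Finset.add_sum_erase _ _ (Finset.mem_univ x)] at h1 h2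
  rw [Finset.sum_congr rfl fun i hi => by rw [if_neg (Finset.ne_of_mem_erase hi)]] at h2
  simp only [if_true] at h2
  linarith

theorem exists_effect_prob_eq_sum {A : C} {Y : Type} [Fintype Y] {a : Y → (A ⟶ 𝟙_ C)}
    (ha : O.IsTest a) {S : Finset Y} (hS : S.Nonempty) :
    ∃ b : A ⟶ 𝟙_ C, ∀ ψ : 𝟙_ C ⟶ A, O.prob (ψ ≫ b) = ∑ j ∈ S, O.prob (ψ ≫ a j) := by
  classical
  -- The range, not `Bool`, is the target: coarse-graining needs a surjection, and `S` may be
  -- everything.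
  let φ : Y → Set.range (fun j => decide (j ∈ S)) := Set.rangeFactorization _
  obtain ⟨g, -, hg⟩ := O.coarse_graining φ Set.rangeFactorization_surjective ha
  obtain ⟨j₀, hj₀⟩ := hS
  refine ⟨g (φ j₀), fun ψ => ?_⟩
  have h := hg (φ j₀) (𝟙_ C) (ψ ≫ (ρ_ A).inv) (ρ_ (𝟙_ C)).hom
  simp only [Category.assoc, rightUnitor_naturality, Iso.inv_hom_id_assoc] at h
  rw [h]
  refine Finset.sum_congr (Finset.ext fun j => ?_) fun _ _ => rfl
  simp [φ, Set.rangeFactorization, hj₀]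

theorem exists_isDet_prob_eq_sum {A : C} {Y : Type} [Fintype Y] [Nonempty Y]
    {a : Y → (A ⟶ 𝟙_ C)} (ha : O.IsTest a) :
    ∃ e : A ⟶ 𝟙_ C, O.IsDet e ∧ ∀ ψ : 𝟙_ C ⟶ A, O.prob (ψ ≫ e) = ∑ j, O.prob (ψ ≫ a j) := by
  obtain ⟨g, hg, h⟩ := O.coarse_graining (fun _ : Y => ()) (fun _ => ⟨Classical.arbitrary Y, rfl⟩) ha
  refine ⟨g (), hg, fun ψ => ?_⟩
  have h := h () (𝟙_ C) (ψ ≫ (ρ_ A).inv) (ρ_ (𝟙_ C)).hom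
  simp only [Category.assoc, rightUnitor_naturality, Iso.inv_hom_id_assoc] at h
  simpa using h

theorem le_opNorm_state_sub {A : C} (φ ψ : 𝟙_ C ⟶ A) (a : A ⟶ 𝟙_ C) {e : A ⟶ 𝟙_ C}
    (he : O.IsDet e) : 2 * (O.prob (φ ≫ a) - O.prob (ψ ≫ a)) -
      (O.prob (φ ≫ e) - O.prob (ψ ≫ e)) ≤ O.opNorm (O.state φ - O.state ψ) := by
  -- Probabilities lie in `[0, 1]`, so `3 = 2 + 1` bounds the set and the real supremum is genuine.
  refine le_csSup ⟨3, ?_⟩ ⟨a, e, he, rfl⟩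
  rintro x ⟨a, e, -, rfl⟩
  simp only [Pi.sub_apply, state]
  linarith [O.prob_nonneg (ψ ≫ a), prob_le_one (O := O) (φ ≫ a), O.prob_nonneg (φ ≫ e),
    prob_le_one (O := O) (ψ ≫ e)]

/-- The `ℓ¹` distance of the outcome distributions of an observation test is at most the
operational norm of the difference of the states. -/
theorem sum_abs_prob_sub_le_opNorm {A : C} {Y : Type} [Fintype Y] [Nonempty Y]
    {a : Y → (A ⟶ 𝟙_ C)} (ha : O.IsTest a) {φ ψ : 𝟙_ C ⟶ A}
    (hφψ : ∀ e : A ⟶ 𝟙_ C, O.IsDet e → O.prob (φ ≫ e) = O.prob (ψ ≫ e)) :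
    ∑ j, |O.prob (φ ≫ a j) - O.prob (ψ ≫ a j)| ≤ O.opNorm (O.state φ - O.state ψ) := by
  classical
  obtain ⟨e, he, hsum⟩ := exists_isDet_prob_eq_sum ha
  set x : Y → ℝ := fun j => O.prob (φ ≫ a j) - O.prob (ψ ≫ a j)
  have hx : ∑ j, x j = 0 := by
    rw [Finset.sum_sub_distrib, ← hsum, ← hsum, hφψ e he, sub_self]
  -- With `≤` rather than `<`, `S` is nonempty even when all differences vanish.
  let S : Finset Y := Finset.univ.filter fun j => 0 ≤ x j
  have hS : S.Nonempty := by
    by_contra h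
    rw [Finset.not_nonempty_iff_eq_empty, Finset.filter_eq_empty_iff] at h
    exact absurd hx (Finset.sum_neg (fun j hj => not_le.1 (h hj)) Finset.univ_nonempty).ne
  obtain ⟨b, hb⟩ := exists_effect_prob_eq_sum ha hS
  have hbx : O.prob (φ ≫ b) - O.prob (ψ ≫ b) = ∑ j, if 0 ≤ x j then x j else 0 := by
    rw [hb, hb, ← Finset.sum_sub_distrib, Finset.sum_filter]
  have key : ∑ j, |x j| = 2 * (O.prob (φ ≫ b) - O.prob (ψ ≫ b)) - ∑ j, x j := by
    rw [hbx, Finset.mul_sum, ← Finset.sum_sub_distrib]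
    refine Finset.sum_congr rfl fun j _ => ?_
    split_ifs with h
    · rw [abs_of_nonneg h]
      ring
    · rw [abs_of_neg (not_le.1 h)]
      ring
  rw [key, hx, ← sub_eq_zero.2 (hφψ e he)]
  exact le_opNorm_state_sub φ ψ b he

theorem infoDisturbance_le_of_disturbance_lt (hO : O.StronglyCausal) {A : C} {r : 𝟙_ C ⟶ A}
    {T : A ⟶ A} (hT : O.IsDet T) {ε : ℝ} (hε : 0 < ε) (hε1 : ε ≤ 1)
    (h : O.disturbance r T < (ε : EReal)) :
    O.infoDisturbance r T ≤ ((6 * (2 * ε + Real.negMulLog ε) : ℝ) : EReal) := by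
  refine sSup_le ?_
  rintro _ ⟨R, Ω, X, Y, _, _, Ψ, a, hΩ, hΨ, hsum, ha, rfl⟩
  rw [EReal.coe_le_coe_iff]
  have hp1 := sum_prob_comp hΨ ha
  have hΨT : O.IsTest (fun i => Ψ i ≫ (T ▷ R)) := IsTest.comp_isDet hΨ (hT.whiskerRight R)
  have hq1 := sum_prob_comp hΨT ha
  simp only [Category.assoc] at hq1
  have hY : Nonempty Y := by
    by_contra h
    rw [not_nonempty_iff] at h
    simp at hp1
  refine normalized_abs_mutualInfo_sub_le (fun _ _ => O.prob_nonneg _)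
    (fun _ _ => O.prob_nonneg _) hp1 hq1 hε hε1 ?_
  have hle : ((∑ i, O.opNorm (O.state (Ψ i ≫ (T ▷ R)) - O.state (Ψ i)) : ℝ) : EReal) < ε := by
    refine lt_of_le_of_lt (le_sSup ?_) h
    -- A whole preparation test is a refinement of its own sum.
    exact ⟨R, Ω, X, inferInstance, Ψ, hΩ,
      ⟨⟨X, Ψ, Function.Embedding.refl X, hΨ, fun _ => rfl⟩, hsum⟩, rfl⟩
  refine (Finset.sum_le_sum fun i _ => ?_).trans (EReal.coe_lt_coe_iff.1 hle).le
  refine le_trans (le_of_eq ?_) (sum_abs_prob_sub_le_opNorm ha fun e he => ?_)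
  · exact Finset.sum_congr rfl fun j _ => by rw [abs_sub_comm, Category.assoc]
  · rw [Category.assoc]
    exact hO.prob_comp_eq ((hT.whiskerRight R).comp he) he (Ψ i)

theorem antitone_rate {A : C} (B : C) (r : 𝟙_ C ⟶ A) : Antitone (O.rate B r) := by
  intro ε ε' h
  refine limsup_le_limsup (Eventually.of_forall fun N => ?_)
  refine ENNReal.div_le_div_right (sInf_le_sInf ?_) _
  rintro x ⟨M, E, D, ⟨hE, hD, hlt⟩, rfl⟩
  exact ⟨M, E, D, ⟨hE, hD, hlt.trans_le (EReal.coe_le_coe_iff.2 h)⟩, rfl⟩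

theorem antitone_infoRate {A : C} (B : C) (r : 𝟙_ C ⟶ A) : Antitone (O.infoRate B r) := by
  intro ε ε' h
  refine limsup_le_limsup (Eventually.of_forall fun N => ?_)
  refine ENNReal.div_le_div_right (sInf_le_sInf ?_) _
  rintro x ⟨M, E, D, ⟨hE, hD, hlt⟩, rfl⟩
  exact ⟨M, E, D, ⟨hE, hD, hlt.trans_le (EReal.coe_le_coe_iff.2 h)⟩, rfl⟩

theorem infoRate_le_rate (hO : O.StronglyCausal) {A : C} (B : C) (r : 𝟙_ C ⟶ A) {ε δ : ℝ}
    (hε : 0 < ε) (hε1 : ε ≤ 1) (hδ : 6 * (2 * ε + Real.negMulLog ε) < δ) :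
    O.infoRate B r δ ≤ O.rate B r ε := by
  refine limsup_le_limsup (Eventually.of_forall fun N => ?_)
  refine ENNReal.div_le_div_right (sInf_le_sInf ?_) _
  rintro x ⟨M, E, D, ⟨hE, hD, hlt⟩, rfl⟩
  exact ⟨M, E, D, ⟨hE, hD, (infoDisturbance_le_of_disturbance_lt hO (hE.comp hD) hε hε1
    hlt).trans_lt (EReal.coe_lt_coe_iff.2 hδ)⟩, rfl⟩

end OPT

theorem mainTheorem5 {C : Type u} [Category.{v} C] [MonoidalCategory C] (O : OPT C)
    (hO : O.StronglyCausal) (B : C) (hB : O.IsObit B) (A : C) (r : 𝟙_ C ⟶ A) (hr : O.IsDet r) :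
    Tendsto (fun ε : ℝ => O.rate B r ε) (𝓝[>] 0) (𝓝 (O.infoContent B r)) ∧
      Tendsto (fun δ : ℝ => O.infoRate B r δ) (𝓝[>] 0) (𝓝 (O.infoContentC B r)) ∧
      O.infoContentC B r ≤ O.infoContent B r := by
  have h1 : Tendsto (fun ε : ℝ => O.rate B r ε) (𝓝[>] 0) (𝓝 (O.infoContent B r)) :=
    tendsto_nhds_limUnder ⟨_, (OPT.antitone_rate B r).tendsto_nhdsGT 0⟩
  have h2 : Tendsto (fun δ : ℝ => O.infoRate B r δ) (𝓝[>] 0) (𝓝 (O.infoContentC B r)) :=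
    tendsto_nhds_limUnder ⟨_, (OPT.antitone_infoRate B r).tendsto_nhdsGT 0⟩
  -- With `δ` fixed, the rates are compared for all small `ε`; `ε` tends to zero before `δ` does.
  refine ⟨h1, h2, le_of_tendsto h2 (eventually_mem_nhdsWithin.mono fun δ hδ => ?_)⟩
  refine ge_of_tendsto h1 ?_
  have hlim : Tendsto (fun ε : ℝ => 6 * (2 * ε + Real.negMulLog ε)) (𝓝[>] 0) (𝓝 0) := by
    have hc : Continuous fun ε : ℝ => 6 * (2 * ε + Real.negMulLog ε) := by
      have := Real.continuous_negMulLog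
      fun_prop
    have := hc.tendsto 0
    simp only [Real.negMulLog_zero, mul_zero, add_zero] at this
    exact this.mono_left nhdsWithin_le_nhds
  filter_upwards [hlim.eventually (gt_mem_nhds hδ), Ioc_mem_nhdsGT (zero_lt_one' ℝ)]
    with ε hεδ hε
  exact OPT.infoRate_le_rate hO B r hε.1 hε.2 hεδ
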